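/- Conventions. A CW complex is Hausdorff and cells are closed cells. A CW complex is locally finite if every cell meets only finitely many cells, and has locally finite type if its $n$-skeleton is locally finite for every $n$. A filtration of a CW complex $X$ is a sequence $C_0\subseteq C_1\subseteq\cdots$ of subcomplexes with union $X$; it is finite if every $C_n$ is a finite subcomplex. For a subcomplex $A$ of $X$ let $X -_c A$ denote the largest subcomplex of $X$ whose set of vertices is $X^0\setminus A^0$. Let $p:Y\to X$ be a covering map of path-connected CW complexes of locally finite type (with the cells of $Y$ being the lifts of the cells of $X$). For $e\in\{0,1,2,\dots,\infty\}$ we say that $Y$ has $e$ filtered ends with respect to $p$ if for some finite filtration $\{C_n\}$ of $X$ the inverse limit $\varprojlim_n \pi_0\bigl(Y -_c p^{-1}(C_n)\bigr)$ has cardinality $e$ (where $\infty$ stands for any infinite cardinality). A free $H$-CW complex is a CW complex with an action of the group $H$ by homeomorphisms that permute the cells of each dimension, the stabilizer of each cell being trivial; its orbit space $H\backslash Y$ carries the CW structure whose cells are the images of the cells of $Y$. Theorem. Let $H$ be a group and let $Y$ be a path-connected free $H$-CW complex of locally finite type. Let $K<H$ be a subgroup of infinite index, and let $p:Y\to H\backslash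 Y$ and $q:Y\to K\backslash Y$ be the quotient covering maps. If $Y$ has $e$ filtered ends with respect to $p$ with $0<e<\infty$, then $Y$ has exactly one filtered end with respect to $q$. -/

import Mathlib

open Topology
open scoped Pointwise

noncomputable section

namespace FilteredEnds

open CWComplex

/-! ### Locally finite type -/

/-- A CW complex is locally finite if every (closed) cell meets only finitely many
(closed) cells. -/
def IsLocallyFinite {X : Type*} [TopologicalSpace X] (C : Set X) [CWComplex C] : Prop :=
  ∀ (n : ℕ) (i : cell C n),
    {d : Σ m, cell C m | (closedCell n i ∩ closedCell d.1 d.2).Nonempty}.Finite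

/-- A CW complex has locally finite type if all its `n`-skeleta are locally finite. -/
def IsLocallyFiniteType {X : Type*} [TopologicalSpace X] [T2Space X] (C : Set X)
    [CWComplex C] : Prop :=
  ∀ n : ℕ, IsLocallyFinite (skeleton C (n : ℕ∞) : Set X)

/-! ### Filtrations, CW complements and the number of filtered ends -/

/-- A filtration of the CW complex `X` by subcomplexes, indexed by the natural numbers. -/
structure Filtration (X : Type*) [TopologicalSpace X] [CWComplex (Set.univ : Set X)] where
  /-- The subcomplexes of the filtration. -/
  sub : ℕ → Subcomplex (Set.univ : Set X)
  mono : ∀ n : ℕ, (sub n : Set X) ⊆ sub (n + 1)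
  exhaust : ⋃ n, (sub n : Set X) = Set.univ

/-- A finite filtration: every member is a finite subcomplex, i.e. has finitely many cells. -/
def Filtration.IsFinite {X : Type*} [TopologicalSpace X] [CWComplex (Set.univ : Set X)]
    (F : Filtration X) : Prop :=
  ∀ n, Finite (Σ k, (F.sub n).I k)

/-- The CW complement of a subcomplex `A`: the largest subcomplex whose vertices are
not in `A`. A cell belongs to it iff it belongs to some subcomplex without vertices in `A`. -/
def cwCompl {X : Type*} [TopologicalSpace X] [T2Space X] [CWComplex (Set.univ : Set X)]
    (A : Subcomplex (Set.univ : Set X)) : Subcomplex (Set.univ : Set X) :=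
  CWComplex.Subcomplex.mk' Set.univ
    (⋃ (E : Subcomplex (Set.univ : Set X)) (_ : Disjoint (E.I 0) (A.I 0)), (E : Set X))
    (fun n => {i | ∃ E : Subcomplex (Set.univ : Set X), Disjoint (E.I 0) (A.I 0) ∧ i ∈ E.I n})
    (by
      rintro n ⟨i, E, hE, hi⟩
      exact (CWComplex.Subcomplex.closedCell_subset_of_mem E hi).trans
        (Set.subset_iUnion₂_of_subset E hE subset_rfl))
    (by
      ext x
      simp only [Set.mem_iUnion]
      constructor
      · rintro ⟨n, ⟨i, E, hE, hi⟩, hx⟩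
        exact ⟨E, hE, CWComplex.Subcomplex.openCell_subset_of_mem E hi hx⟩
      · rintro ⟨E, hE, hx⟩
        rw [← CWComplex.Subcomplex.union (E := E)] at hx
        simp only [Set.mem_iUnion] at hx
        obtain ⟨n, ⟨i, hi⟩, hx⟩ := hx
        exact ⟨n, ⟨i, E, hE, hi⟩, hx⟩)

theorem cell_mem_of_subset {X : Type*} [TopologicalSpace X] [CWComplex (Set.univ : Set X)]
    {A B : Subcomplex (Set.univ : Set X)} (h : (A : Set X) ⊆ B) (n : ℕ) : A.I n ⊆ B.I n := by
  intro i hi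
  by_contra hB
  have h1 := CWComplex.Subcomplex.disjoint_openCell_subcomplex_of_not_mem B hB
  have hx := RelCWComplex.map_zero_mem_openCell n i
  refine Set.disjoint_left.1 h1 hx (h ?_)
  rw [← CWComplex.Subcomplex.union (E := A)]
  exact Set.mem_iUnion₂.2 ⟨n, ⟨i, hi⟩, hx⟩

theorem cwCompl_anti {X : Type*} [TopologicalSpace X] [T2Space X]
    [CWComplex (Set.univ : Set X)] {A B : Subcomplex (Set.univ : Set X)}
    (h : (A : Set X) ⊆ B) : (cwCompl B : Set X) ⊆ cwCompl A := by
  intro x hx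
  obtain ⟨E, hE, hx⟩ := Set.mem_iUnion₂.1 hx
  exact Set.mem_iUnion₂.2 ⟨E, hE.mono_right (cell_mem_of_subset h 0), hx⟩

/-- The map on sets of path components induced by an inclusion of subspaces. -/
def pi0Incl {X : Type*} [TopologicalSpace X] {S T : Set X} (h : S ⊆ T) :
    ZerothHomotopy S → ZerothHomotopy T :=
  ZerothHomotopy.lift (fun x => ZerothHomotopy.mk (Set.inclusion h x))
    (fun _ _ γ => ZerothHomotopy.sound (γ.map (continuous_inclusion h)))

/-- The inverse limit of the sets of path components of the CW complements of the members
of a filtration. -/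
def EndSpace {Y : Type*} [TopologicalSpace Y] [T2Space Y] [CWComplex (Set.univ : Set Y)]
    (L : Filtration Y) : Type _ :=
  {c : ∀ n, ZerothHomotopy (cwCompl (L.sub n) : Set Y) //
    ∀ n, pi0Incl (cwCompl_anti (L.mono n)) (c (n + 1)) = c n}

/-- The number of filtered ends of a filtered CW complex, as an element of `{0, 1, …, ∞}`. -/
def Filtration.numEnds {Y : Type*} [TopologicalSpace Y] [T2Space Y]
    [CWComplex (Set.univ : Set Y)] (L : Filtration Y) : ℕ∞ :=
  ENat.card (EndSpace L)

/-- `Y` has `e` filtered ends over the (cellular covering) map `p : Y → X`: for some finite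
filtration `C` of `X`, the filtration `n ↦ p ⁻¹' (C n)` of `Y` has `e` filtered ends. -/
def HasFilteredEnds {Y X : Type*} [TopologicalSpace Y] [T2Space Y]
    [CWComplex (Set.univ : Set Y)] [TopologicalSpace X] [CWComplex (Set.univ : Set X)]
    (p : Y → X) (e : ℕ∞) : Prop :=
  ∃ C : Filtration X, C.IsFinite ∧
    ∃ L : Filtration Y, (∀ n, (L.sub n : Set Y) = p ⁻¹' (C.sub n : Set X)) ∧ L.numEnds = e

/-! ### Free `H`-CW complexes and their quotients -/

/-- `Y` is a free `H`-CW complex: `H` acts by homeomorphisms that permute the open cells of each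
dimension, and the stabilizer of every cell is trivial (so the action is free). -/
class FreeGCW (H Y : Type*) [Group H] [TopologicalSpace Y] [MulAction H Y]
    [CWComplex (Set.univ : Set Y)] : Prop where
  continuous_smul : ∀ g : H, Continuous (fun y : Y => g • y)
  smul_cell : ∀ (g : H) (n : ℕ) (i : cell (Set.univ : Set Y) n),
    ∃ j : cell (Set.univ : Set Y) n, g • openCell n i = openCell n j
  free : ∀ (g : H) (n : ℕ) (i : cell (Set.univ : Set Y) n),
    g • openCell n i = openCell n i → g = 1

instance {H Y : Type*} [Group H] [TopologicalSpace Y] [MulAction H Y]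
    [CWComplex (Set.univ : Set Y)] [FreeGCW H Y] (K : Subgroup H) : FreeGCW K Y where
  continuous_smul g := FreeGCW.continuous_smul (g : H)
  smul_cell g n i := FreeGCW.smul_cell (g : H) n i
  free g n i h := Subtype.ext (FreeGCW.free (g : H) n i h)

section Quotient

set_option linter.unusedSectionVars false

variable (H : Type*) {Y : Type*} [Group H] [TopologicalSpace Y] [MulAction H Y]

/-- The quotient map `Y → H\Y` onto the orbit space. -/
def orbitMap : Y → MulAction.orbitRel.Quotient H Y := Quotient.mk _

theorem orbitMap_eq_iff {x y : Y} : orbitMap H x = orbitMap H y ↔ ∃ g : H, g • y = x :=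
  Quotient.eq

theorem isQuotientMap_orbitMap : IsQuotientMap (orbitMap H : Y → _) := isQuotientMap_quotient_mk'

theorem orbitMap_image_smul (g : H) (S : Set Y) : orbitMap H '' (g • S) = orbitMap H '' S := by
  ext z
  constructor
  · rintro ⟨_, ⟨y, hy, rfl⟩, rfl⟩
    exact ⟨y, hy, (orbitMap_eq_iff H).2 ⟨g⁻¹, by simp⟩⟩
  · rintro ⟨y, hy, rfl⟩
    exact ⟨g • y, ⟨y, hy, rfl⟩, (orbitMap_eq_iff H).2 ⟨g, rfl⟩⟩

theorem preimage_image_orbitMap (S : Set Y) :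
    orbitMap H ⁻¹' (orbitMap H '' S) = ⋃ g : H, g • S := by
  ext y
  simp only [Set.mem_preimage, Set.mem_image, Set.mem_iUnion, orbitMap_eq_iff]
  constructor
  · rintro ⟨x, hx, g, hg⟩
    exact ⟨g⁻¹, x, hx, by simp [← hg]⟩
  · rintro ⟨g, x, hx, rfl⟩
    exact ⟨x, hx, g⁻¹, by simp⟩

variable [CWComplex (Set.univ : Set Y)]

/-- Two cells are equivalent if they lie in the same `H`-orbit. -/
def cellSetoid (n : ℕ) : Setoid (cell (Set.univ : Set Y) n) where
  r i j := ∃ g : H, g • openCell n i = openCell n j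
  iseqv :=
    { refl := fun i => ⟨1, one_smul _ _⟩
      symm := by
        rintro i j ⟨g, h⟩
        exact ⟨g⁻¹, by rw [← h, inv_smul_smul]⟩
      trans := by
        rintro i j k ⟨g, h⟩ ⟨g', h'⟩
        exact ⟨g' * g, by rw [mul_smul, h, h']⟩ }

variable (Y) in
/-- The `n`-cells of `H\Y` are the `H`-orbits of `n`-cells of `Y`. -/
abbrev QuotCell (n : ℕ) : Type _ := Quotient (cellSetoid H (Y := Y) n)

theorem exists_smul_eq_out (n : ℕ) (j : cell (Set.univ : Set Y) n) :
    ∃ g : H, g • openCell n j =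
      openCell n (Quotient.mk (cellSetoid H n) j).out :=
  (cellSetoid H n).symm (Quotient.mk_out (s := cellSetoid H n) j)

variable {H}

theorem smul_closedCell [T2Space Y] [FreeGCW H Y] {g : H} {n : ℕ}
    {i j : cell (Set.univ : Set Y) n} (h : g • openCell n i = openCell n j) :
    g • closedCell n i = closedCell n j := by
  have : ContinuousConstSMul H Y := ⟨FreeGCW.continuous_smul⟩
  rw [← closure_openCell_eq_closedCell, ← closure_openCell_eq_closedCell, ← h, closure_smul]

theorem smul_openCell_of_mem [FreeGCW H Y] {g : H} {n m : ℕ} {i : cell (Set.univ : Set Y) n}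
    {j : cell (Set.univ : Set Y) m} {y : Y} (hy : y ∈ openCell n i)
    (hgy : g • y ∈ openCell m j) :
    n = m ∧ g • openCell n i = openCell m j := by
  obtain ⟨k, hk⟩ := FreeGCW.smul_cell g n i
  have hgy' : g • y ∈ openCell n k := hk ▸ Set.smul_mem_smul_set hy
  have : (⟨n, k⟩ : Σ n, cell (Set.univ : Set Y) n) = ⟨m, j⟩ := by
    by_contra hne
    exact Set.disjoint_left.1 (disjoint_openCell_of_ne hne) hgy' hgy
  cases this
  exact ⟨rfl, hk⟩

theorem eq_one_of_mem_openCell [FreeGCW H Y] {g : H} {n : ℕ} {i : cell (Set.univ : Set Y) n}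
    {y : Y} (hy : y ∈ openCell n i) (hgy : g • y ∈ openCell n i) : g = 1 := by
  obtain ⟨-, h⟩ := smul_openCell_of_mem hy hgy
  exact FreeGCW.free g n i h

theorem closedCell_subset_finite_openCell (n : ℕ) (i : cell (Set.univ : Set Y) n) :
    ∃ F : Set (Σ m, cell (Set.univ : Set Y) m), F.Finite ∧
      closedCell n i ⊆ ⋃ d ∈ F, openCell d.1 d.2 := by
  classical
  obtain ⟨I, hI⟩ := CWComplex.cellFrontier_subset_finite_openCell n i
  refine ⟨insert ⟨n, i⟩ (⋃ m ∈ Finset.range n, (Sigma.mk m) '' (I m : Set _)), ?_, ?_⟩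
  · refine Set.Finite.insert _ (Set.Finite.biUnion (Finset.finite_toSet _) fun m _ => ?_)
    exact (Finset.finite_toSet _).image _
  · intro x hx
    rw [← cellFrontier_union_openCell_eq_closedCell] at hx
    rcases hx with hx | hx
    · have := hI hx
      simp only [Set.mem_iUnion] at this
      obtain ⟨m, hm, j, hj, hx⟩ := this
      refine Set.mem_iUnion₂.2 ⟨⟨m, j⟩, Or.inr ?_, hx⟩
      exact Set.mem_iUnion₂.2 ⟨m, Finset.mem_range.2 hm, j, hj, rfl⟩
    · exact Set.mem_iUnion₂.2 ⟨⟨n, i⟩, Or.inl rfl, hx⟩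

theorem finite_smul_meets [FreeGCW H Y] {n m : ℕ} (i : cell (Set.univ : Set Y) n)
    (j : cell (Set.univ : Set Y) m) :
    {g : H | (g • closedCell n i ∩ closedCell m j).Nonempty}.Finite := by
  obtain ⟨F, hF, hi⟩ := closedCell_subset_finite_openCell n i
  obtain ⟨G, hG, hj⟩ := closedCell_subset_finite_openCell m j
  refine Set.Finite.subset (hF.biUnion fun d _ => hG.biUnion (t := fun d' =>
    {g : H | ∃ y ∈ openCell d.1 d.2, g • y ∈ openCell d'.1 d'.2}) fun d' _ => ?_) ?_
  · refine Set.Subsingleton.finite ?_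
    rintro g ⟨y, hy, hgy⟩ g' ⟨y', hy', hgy'⟩
    obtain ⟨n', k⟩ := d
    obtain ⟨m', k'⟩ := d'
    obtain ⟨-, e⟩ := smul_openCell_of_mem hy hgy
    obtain ⟨-, e'⟩ := smul_openCell_of_mem hy' hgy'
    have : g⁻¹ * g' = 1 := FreeGCW.free _ n' k (by
      have e1 : g' • openCell n' k = g • openCell n' k := e'.trans e.symm
      rw [mul_smul, e1, inv_smul_smul])
    exact inv_mul_eq_one.1 this
  · rintro g ⟨_, ⟨y, hy, rfl⟩, hgy⟩
    obtain ⟨d, hd, hyd⟩ := Set.mem_iUnion₂.1 (hi hy)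
    obtain ⟨d', hd', hyd'⟩ := Set.mem_iUnion₂.1 (hj hgy)
    exact Set.mem_iUnion₂.2 ⟨d, hd, Set.mem_iUnion₂.2 ⟨d', hd', y, hyd, hyd'⟩⟩

theorem isClosed_image_orbitMap [T2Space Y] [FreeGCW H Y] {n : ℕ}
    {i : cell (Set.univ : Set Y) n} {S : Set Y} (hS : IsClosed S) (hSi : S ⊆ closedCell n i) :
    IsClosed (orbitMap H '' S) := by
  have : ContinuousConstSMul H Y := ⟨FreeGCW.continuous_smul⟩
  rw [← (isQuotientMap_orbitMap H).isClosed_preimage, preimage_image_orbitMap,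
    CWComplex.closed Set.univ _ (Set.subset_univ _)]
  intro m j
  have : (⋃ g : H, g • S) ∩ closedCell m j =
      ⋃ g ∈ {g : H | (g • closedCell n i ∩ closedCell m j).Nonempty},
        g • S ∩ closedCell m j := by
    ext y
    simp only [Set.mem_inter_iff, Set.mem_iUnion, Set.mem_ofPred_eq, exists_prop]
    constructor
    · rintro ⟨⟨g, hg⟩, hy⟩
      exact ⟨g, ⟨y, Set.smul_set_mono hSi hg, hy⟩, hg, hy⟩
    · rintro ⟨g, -, hg, hy⟩
      exact ⟨⟨g, hg⟩, hy⟩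
  rw [this]
  exact (finite_smul_meets i j).isClosed_biUnion fun g _ =>
    (hS.smul g).inter isClosed_closedCell

theorem injOn_orbitMap_map [FreeGCW H Y] (n : ℕ) (i : cell (Set.univ : Set Y) n) :
    Set.InjOn (orbitMap H ∘ map n i) (Metric.ball 0 1) := by
  intro x hx x' hx' h
  obtain ⟨g, hg⟩ := (orbitMap_eq_iff H).1 h
  have hg1 : g = 1 := eq_one_of_mem_openCell (i := i) (y := map n i x') ⟨x', hx', rfl⟩
    (hg ▸ ⟨x, hx, rfl⟩)
  subst hg1
  rw [one_smul] at hg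
  exact (map n i).injOn (by rwa [source_eq]) (by rwa [source_eq]) hg.symm

theorem disjoint_image_ball_sphere [FreeGCW H Y] (n : ℕ) (i : cell (Set.univ : Set Y) n)
    {x x' : Fin n → ℝ} (hx : x ∈ Metric.ball 0 1) (hx' : x' ∈ Metric.sphere 0 1) :
    orbitMap H (map n i x) ≠ orbitMap H (map n i x') := by
  intro h
  obtain ⟨g, hg⟩ := (orbitMap_eq_iff H).1 h
  obtain ⟨I, hI⟩ := CWComplex.cellFrontier_subset_finite_openCell n i
  have h1 := hI ⟨x', hx', rfl⟩
  simp only [Set.mem_iUnion] at h1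
  obtain ⟨m, hm, j, -, hj⟩ := h1
  have h2 : g • map n i x' ∈ openCell n i := hg ▸ ⟨x, hx, rfl⟩
  obtain ⟨e, -⟩ := smul_openCell_of_mem hj h2
  omega

variable (H Y)

/-- The CW structure of the orbit space `H\Y` of a free `H`-CW complex `Y`: its cells are the
images of the cells of `Y`, one for each orbit of cells, and the characteristic map of an orbit
is the characteristic map of a representative followed by the quotient map. -/
instance quotientCW [T2Space Y] [FreeGCW H Y] :
    CWComplex (Set.univ : Set (MulAction.orbitRel.Quotient H Y)) where
  cell n := QuotCell H Y n
  map n c := Set.InjOn.toPartialEquiv _ _ (injOn_orbitMap_map (H := H) n c.out)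
  source_eq n c := rfl
  continuousOn n c := (isQuotientMap_orbitMap H).continuous.comp_continuousOn
    (continuousOn n c.out)
  continuousOn_symm n c := by
    rw [continuousOn_iff_isClosed]
    intro A hA
    have hinj := injOn_orbitMap_map (H := H) n c.out
    refine ⟨orbitMap H '' (map n c.out '' (A ∩ Metric.closedBall 0 1)), ?_, ?_⟩
    · refine isClosed_image_orbitMap (n := n) (i := c.out) ?_
        (Set.image_mono Set.inter_subset_right)
      exact (((isCompact_closedBall _ _).inter_left hA).image_of_continuousOn
        ((continuousOn n c.out).mono Set.inter_subset_right)).isClosed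
    · ext z
      simp only [Set.mem_inter_iff]
      refine and_congr_left fun hz => ?_
      obtain ⟨x, hx, rfl⟩ : z ∈ (orbitMap H ∘ map n c.out) '' Metric.ball 0 1 := hz
      have hx' : (Set.InjOn.toPartialEquiv _ _ hinj).symm ((Set.InjOn.toPartialEquiv _ _ hinj) x) = x :=
        (Set.InjOn.toPartialEquiv _ _ hinj).left_inv hx
      rw [Set.mem_preimage]
      constructor
      · intro h
        have h' : x ∈ A := hx' ▸ h
        exact ⟨_, ⟨x, ⟨h', Metric.ball_subset_closedBall hx⟩, rfl⟩, rfl⟩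
      · rintro ⟨_, ⟨x', ⟨hA', hb⟩, rfl⟩, e⟩
        rw [← Metric.sphere_union_ball] at hb
        rcases hb with hb | hb
        · exact absurd e.symm (disjoint_image_ball_sphere n _ hx hb)
        · have : x' = x := hinj hb hx e
          have h' : (Set.InjOn.toPartialEquiv _ _ hinj).symm ((Set.InjOn.toPartialEquiv _ _ hinj) x) ∈ A := by
            rw [hx']; exact this ▸ hA'
          exact h'
  pairwiseDisjoint' := by
    rintro ⟨n, c⟩ - ⟨m, d⟩ - hne
    refine Set.disjoint_left.2 ?_
    rintro _ ⟨x, hx, rfl⟩ ⟨x', hx', h⟩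
    apply hne
    obtain ⟨g, hg⟩ := (orbitMap_eq_iff H).1 h
    have h1 : map n c.out x ∈ openCell n c.out := ⟨x, hx, rfl⟩
    have h2 : g • map n c.out x ∈ openCell m d.out := hg ▸ ⟨x', hx', rfl⟩
    obtain ⟨e, h3⟩ := smul_openCell_of_mem h1 h2
    subst e
    have h4 : c = d := by
      rw [← Quotient.out_eq c, ← Quotient.out_eq d]
      exact Quotient.sound ⟨g, h3⟩
    rw [h4]
  mapsTo' n c := by
    classical
    obtain ⟨I, hI⟩ := CWComplex.mapsTo n c.out
    refine ⟨fun m => (I m).image (Quotient.mk (cellSetoid H m)), ?_⟩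
    intro x hx
    have h1 := hI hx
    simp only [Set.mem_iUnion] at h1 ⊢
    obtain ⟨m, hm, j, hj, hxj⟩ := h1
    refine ⟨m, hm, Quotient.mk (cellSetoid H _) j, Finset.mem_image_of_mem _ hj, ?_⟩
    obtain ⟨g, hg⟩ := exists_smul_eq_out H m j
    have h2 := smul_closedCell hg
    obtain ⟨y, hy, hy'⟩ : g • map n c.out x ∈ closedCell m _ := h2 ▸ Set.smul_mem_smul_set hxj
    refine ⟨y, hy, ?_⟩
    exact (orbitMap_eq_iff H).2 ⟨g, hy'.symm⟩
  closed' A _ h := by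
    rw [← (isQuotientMap_orbitMap H).isClosed_preimage,
      CWComplex.closed Set.univ _ (Set.subset_univ _)]
    intro n j
    obtain ⟨g, hg⟩ := exists_smul_eq_out H n j
    have h1 := h n (Quotient.mk (cellSetoid H _) j)
    have h2 : orbitMap H ⁻¹' A ∩ closedCell n j =
        orbitMap H ⁻¹' (A ∩ orbitMap H '' closedCell n j) ∩ closedCell n j := by
      ext y
      constructor
      · rintro ⟨ha, hy⟩
        exact ⟨⟨ha, y, hy, rfl⟩, hy⟩
      · rintro ⟨⟨ha, -⟩, hy⟩
        exact ⟨ha, hy⟩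
    rw [h2, ← orbitMap_image_smul H g, smul_closedCell hg, closedCell, ← Set.image_comp]
    exact (h1.preimage (isQuotientMap_orbitMap H).continuous).inter isClosed_closedCell
  union' := by
    refine Set.eq_univ_of_forall fun z => ?_
    obtain ⟨y, rfl⟩ := (isQuotientMap_orbitMap H).surjective z
    have hy : y ∈ ⋃ (n : ℕ) (j : cell (Set.univ : Set Y) n), closedCell n j := by
      rw [CWComplex.union]; trivial
    simp only [Set.mem_iUnion] at hy ⊢
    obtain ⟨n, j, hy⟩ := hy
    refine ⟨n, Quotient.mk (cellSetoid H _) j, ?_⟩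
    obtain ⟨g, hg⟩ := exists_smul_eq_out H n j
    obtain ⟨x, hx, hx'⟩ : g • y ∈ closedCell n _ := smul_closedCell hg ▸ Set.smul_mem_smul_set hy
    exact ⟨x, hx, (orbitMap_eq_iff H).2 ⟨g, hx'.symm⟩⟩

end Quotient

end FilteredEnds

end

namespace FilteredEnds

open CWComplex

/-! The end count depends only on vertices: the CW complement of `A` is the full subcomplex on the
vertices outside `A`, and each of its points is joined in it to a vertex. Ends thus become classes
of rays of vertices, one vertex per stage, consecutive ones joined in the relevant complement.
`Connectivity` records what is needed: equivariance, finite sets joining any two points, and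
finitely many neighbours through which any proper subset can be left.

Let `A` be the `H`-cofinite exhaustion, with finitely many ends and at least one. A subgroup `N` of
finite index in `H` fixes every end. Let `D` be a `K`-cofinite set. Two `A`-rays are joined at a
late stage by a finite set `P`. Since the action is free, the `h` for which `h • P` meets `D` fill
only finitely many right cosets of `K`, and these cannot cover `N` as `K` has infinite index. So
some `h` in `N` moves `P` off `D`, and since `h` fixes both ends, the original rays are joined
outside `D` (`joined_of_rays`). All ends of `A` thus give the same end of any `K`-cofinite
exhaustion.

There is no other end. A component `W` of the complement of `D n` missing that end contains no late
point of an `A`-ray. Components of complements in `A` that are not bounded contain rays, so `W` lies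
in some `A k`, that is, in finitely many `H`-orbits. Each `w = h • f` in `W` comes with a translated
finite set `h • P f` reaching an `A`-ray. That set must meet `D n`, which confines `h` to finitely
many cosets of `K`. Hence `W` lies in some `D B`, and no `D`-ray can stay in it
(`exists_unique_ray`). -/

/-- An equivariant notion of two points being joined inside a subset, for which every subset
can be left only through the neighbours of its complement. -/
structure Connectivity (H V : Type*) [Group H] [MulAction H V] where
  /-- `joined S v w` says that `v` and `w` lie in the same component of `S`. -/
  joined : Set V → V → V → Prop
  /-- The neighbours of a point. -/
  nbhd : V → Set V
  refl : ∀ {S v}, v ∈ S → joined S v v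
  left_mem : ∀ {S v w}, joined S v w → v ∈ S
  symm : ∀ {S v w}, joined S v w → joined S w v
  trans : ∀ {S u v w}, joined S u v → joined S v w → joined S u w
  mono : ∀ {S T v w}, S ⊆ T → joined S v w → joined T v w
  smul : ∀ {S v w} (h : H), joined S v w → joined (h • S) (h • v) (h • w)
  exists_finite : ∀ v w, ∃ P : Set V, P.Finite ∧ joined P v w
  finite_nbhd : ∀ v, (nbhd v).Finite
  smul_nbhd : ∀ {u v} (h : H), u ∈ nbhd v → h • u ∈ nbhd (h • v)
  exists_nbhd : ∀ {S : Set V} {v w}, v ∈ S → w ∉ S → ∃ u, joined S v u ∧ ∃ x ∉ S, u ∈ nbhd x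

/-- An exhausting increasing sequence of invariant subsets with finitely many orbits. -/
structure CofiniteExhaustion (H : Type*) {V : Type*} [Group H] [MulAction H V]
    (A : ℕ → Set V) : Prop where
  mono : Monotone A
  exhaust : ∀ v, ∃ n, v ∈ A n
  smul_mem : ∀ {n v} (h : H), v ∈ A n → h • v ∈ A n
  finite : ∀ n, ∃ F : Set V, F.Finite ∧ ∀ v ∈ A n, ∃ f ∈ F, ∃ h : H, v = h • f

namespace CofiniteExhaustion

variable {H V : Type*} [Group H] [MulAction H V] {A : ℕ → Set V}

theorem smul_mem_iff (hA : CofiniteExhaustion H A) {n : ℕ} {v : V} (h : H) :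
    h • v ∈ A n ↔ v ∈ A n :=
  ⟨fun hv => by simpa using hA.smul_mem h⁻¹ hv, hA.smul_mem h⟩

theorem smul_compl (hA : CofiniteExhaustion H A) (n : ℕ) (h : H) : h • (A n)ᶜ = (A n)ᶜ := by
  ext v
  rw [Set.mem_smul_set_iff_inv_smul_mem, Set.mem_compl_iff, Set.mem_compl_iff, hA.smul_mem_iff]

theorem exists_finite_subset (hA : CofiniteExhaustion H A) {F : Set V} (hF : F.Finite) :
    ∃ n, F ⊆ A n := by
  choose N hN using hA.exhaust
  obtain ⟨n, hn⟩ := (hF.image N).bddAbove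
  exact ⟨n, fun v hv => hA.mono (hn ⟨v, hv, rfl⟩) (hN v)⟩

end CofiniteExhaustion

/-! ### Rays, ends and unbounded components -/

namespace Connectivity

variable {H V : Type*} [Group H] [MulAction H V] (J : Connectivity H V) {A : ℕ → Set V}

theorem right_mem {S : Set V} {v w : V} (h : J.joined S v w) : w ∈ S := J.left_mem (J.symm h)

/-- Sequences running through a compatible sequence of components of the complements. -/
def IsRay (A : ℕ → Set V) (r : ℕ → V) : Prop := ∀ n, J.joined (A n)ᶜ (r n) (r (n + 1))

theorem IsRay.mem {J : Connectivity H V} {r : ℕ → V} (hr : J.IsRay A r) (n : ℕ) : r n ∉ A n :=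
  J.left_mem (hr n)

theorem IsRay.joined_of_le {J : Connectivity H V} {r : ℕ → V} (hA : Monotone A)
    (hr : J.IsRay A r) {i j : ℕ} (hij : i ≤ j) : J.joined (A i)ᶜ (r i) (r j) := by
  induction j, hij using Nat.le_induction with
  | base => exact J.refl (hr.mem i)
  | succ j hij ih => exact J.trans ih (J.mono (Set.compl_subset_compl.2 (hA hij)) (hr j))

theorem IsRay.joined_of_subset {J : Connectivity H V} {r : ℕ → V} (hA : Monotone A)
    (hr : J.IsRay A r) {D : Set V} {i j : ℕ} (hi : D ⊆ A i) (hj : D ⊆ A j) :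
    J.joined Dᶜ (r i) (r j) := by
  rcases le_total i j with h | h
  · exact J.mono (Set.compl_subset_compl.2 hi) (hr.joined_of_le hA h)
  · exact J.symm (J.mono (Set.compl_subset_compl.2 hj) (hr.joined_of_le hA h))

theorem smul_compl {hA : CofiniteExhaustion H A} {n : ℕ} {v w : V} (h : H)
    (hvw : J.joined (A n)ᶜ v w) : J.joined (A n)ᶜ (h • v) (h • w) := by
  simpa only [hA.smul_compl n h] using J.smul h hvw

theorem IsRay.smul {J : Connectivity H V} {r : ℕ → V} (hA : CofiniteExhaustion H A)
    (hr : J.IsRay A r) (h : H) : J.IsRay A (fun n => h • r n) :=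
  fun n => J.smul_compl (hA := hA) h (hr n)

/-- The set of rays. -/
abbrev Ray (A : ℕ → Set V) := {r : ℕ → V // J.IsRay A r}

/-- Two rays are equivalent if they run through the same components. -/
def raySetoid (A : ℕ → Set V) : Setoid (J.Ray A) where
  r r s := ∀ n, J.joined (A n)ᶜ (r.1 n) (s.1 n)
  iseqv :=
    { refl := fun r n => J.refl (r.2.mem n)
      symm := fun h n => J.symm (h n)
      trans := fun h h' n => J.trans (h n) (h' n) }

/-- The ends of an exhaustion. -/
abbrev Ends (A : ℕ → Set V) := Quotient (J.raySetoid A)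

/-- The action of the group on the ends. -/
@[reducible]
def endsAction (hA : CofiniteExhaustion H A) : MulAction H (J.Ends A) where
  smul h := Quotient.map (sa := J.raySetoid A) (sb := J.raySetoid A)
    (fun r => ⟨fun n => h • r.1 n, r.2.smul hA h⟩)
    (fun _ _ hrs n => J.smul_compl (hA := hA) h (hrs n))
  one_smul := by
    rintro ⟨r⟩
    exact Quotient.sound fun n => by simpa using J.refl (r.2.mem n)
  mul_smul := by
    rintro g h ⟨r⟩
    refine Quotient.sound fun n => ?_
    change J.joined (A n)ᶜ ((g * h) • r.1 n) (g • h • r.1 n)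
    rw [← mul_smul]
    exact J.refl ((r.2.smul hA (g * h)).mem n)

/-- The kernel of a permutation action on a finite set has finite index. -/
theorem exists_finiteIndex_fixing (hA : CofiniteExhaustion H A) [Finite (J.Ends A)] :
    ∃ N : Subgroup H, N.FiniteIndex ∧ ∀ h ∈ N, ∀ r, J.IsRay A r →
      ∀ n, J.joined (A n)ᶜ (h • r n) (r n) := by
  let := J.endsAction hA
  refine ⟨(MulAction.toPermHom H (J.Ends A)).ker, inferInstance, fun h hh r hr n => ?_⟩
  have h1 := DFunLike.congr_fun (MonoidHom.mem_ker.1 hh) (Quotient.mk (J.raySetoid A) ⟨r, hr⟩)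
  exact (Quotient.exact h1 : (J.raySetoid A).r _ _) n

/-- Up to translation, the complement of a member has finitely many components. -/
theorem exists_finite_reps (hA : CofiniteExhaustion H A) (m : ℕ) :
    ∃ N : Set V, N.Finite ∧ ∀ v ∉ A m, ∃ u ∈ N, ∃ h : H, J.joined (A m)ᶜ v (h • u) := by
  rcases (A m).eq_empty_or_nonempty with h0 | ⟨w, hw⟩
  · rcases isEmpty_or_nonempty V with hV | ⟨⟨v₀⟩⟩
    · exact ⟨∅, Set.finite_empty, fun v => (hV.false v).elim⟩
    · refine ⟨{v₀}, Set.finite_singleton _, fun v _ => ⟨v₀, rfl, 1, ?_⟩⟩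
      obtain ⟨P, -, hP⟩ := J.exists_finite v v₀
      rw [one_smul]
      exact J.mono (by simp [h0]) hP
  · obtain ⟨F, hF, hFA⟩ := hA.finite m
    refine ⟨⋃ f ∈ F, J.nbhd f, hF.biUnion fun f _ => J.finite_nbhd f, fun v hv => ?_⟩
    -- Leaving the complement passes through a neighbour of `A m`, and these neighbours form
    -- finitely many orbits.
    obtain ⟨u, hu, x, hx, hux⟩ := J.exists_nbhd (S := (A m)ᶜ) hv (not_not.2 hw)
    obtain ⟨f, hf, h, rfl⟩ := hFA x (not_not.1 hx)
    refine ⟨h⁻¹ • u, Set.mem_iUnion₂.2 ⟨f, hf, ?_⟩, h, by simpa using hu⟩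
    simpa using J.smul_nbhd h⁻¹ hux

/-- The component of `v` in the complement of `A m` is contained in no `A k`. -/
def Unbounded (A : ℕ → Set V) (m : ℕ) (v : V) : Prop := ∀ k, ∃ w ∉ A k, J.joined (A m)ᶜ v w

/-- Translation preserves every `A k`, and there are finitely many components up to translation, so
one `A k` contains all the bounded ones. -/
theorem exists_unbounded (hA : CofiniteExhaustion H A) (m : ℕ) :
    ∃ k, ∀ v ∉ A k, J.Unbounded A m v := by
  obtain ⟨N, hN, hNv⟩ := J.exists_finite_reps hA m
  have key : ∀ u : V, ∃ k, J.Unbounded A m u ∨ ∀ w, J.joined (A m)ᶜ u w → w ∈ A k := by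
    intro u
    by_cases hu : J.Unbounded A m u
    · exact ⟨0, Or.inl hu⟩
    · simp only [Unbounded, not_forall, not_exists, not_and'] at hu
      obtain ⟨k, hk⟩ := hu
      exact ⟨k, Or.inr fun w hw => not_not.1 (hk w hw)⟩
  choose K hK using key
  obtain ⟨k, hk⟩ := (hN.image K).bddAbove
  refine ⟨max k m, fun v hv k' => ?_⟩
  obtain ⟨u, hu, h, hvu⟩ := hNv v fun hv' => hv (hA.mono (le_max_right _ _) hv')
  rcases hK u with hun | hb
  · obtain ⟨w, hw, huw⟩ := hun k'
    exact ⟨h • w, fun h' => hw ((hA.smul_mem_iff h).1 h'),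
      J.trans hvu (J.smul_compl (hA := hA) h huw)⟩
  · have h1 := hb (h⁻¹ • v) (by simpa using J.smul_compl (hA := hA) h⁻¹ (J.symm hvu))
    exact absurd (hA.mono ((hk ⟨u, hu, rfl⟩).trans (le_max_left _ _))
      ((hA.smul_mem_iff _).1 h1)) hv

/-- Every unbounded component contains a ray. -/
theorem Unbounded.exists_ray {J : Connectivity H V} (hA : CofiniteExhaustion H A) {m : ℕ} {v : V}
    (hv : J.Unbounded A m v) : ∃ r, J.IsRay A r ∧ r m = v := by
  have step : ∀ n v, ∃ w, J.Unbounded A n v →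
      J.joined (A n)ᶜ v w ∧ J.Unbounded A (n + 1) w := by
    intro n v
    -- Moving within the component to a point outside this `A k` makes its component at the next
    -- stage unbounded too.
    obtain ⟨k, hk⟩ := J.exists_unbounded hA (n + 1)
    by_cases hv : J.Unbounded A n v
    · obtain ⟨w, hw, hvw⟩ := hv k
      exact ⟨w, fun _ => ⟨hvw, hk w hw⟩⟩
    · exact ⟨v, fun h => absurd h hv⟩
  choose f hf using step
  let s : ℕ → V := fun i => Nat.rec v (fun i w => f (m + i) w) i
  have hs : ∀ i, J.Unbounded A (m + i) (s i) := by
    intro i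
    induction i with
    | zero => exact hv
    | succ i ih => exact (hf _ _ ih).2
  -- Truncated subtraction keeps the ray constant at `v` before stage `m`, which is harmless as `v`
  -- avoids the smaller sets.
  refine ⟨fun n => s (n - m), fun n => ?_, by simp [s]⟩
  rcases lt_or_ge n m with h | h
  · obtain ⟨w, -, hw⟩ := hv 0
    have h1 : n - m = 0 := by omega
    have h2 : n + 1 - m = 0 := by omega
    simp only [h1, h2]
    exact J.refl fun h' => J.left_mem hw (hA.mono h.le h')
  · obtain ⟨i, rfl⟩ := Nat.exists_eq_add_of_le h
    have h1 : m + i - m = i := by omega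
    have h2 : m + i + 1 - m = i + 1 := by omega
    simp only [h1, h2]
    exact (hf _ _ (hs i)).1

end Connectivity

/-! ### Subgroups of infinite index -/

/-- A subgroup of finite index is not covered by finitely many right cosets of a subgroup of
infinite index. -/
theorem exists_mem_forall_mul_inv_notMem {H : Type*} [Group H] (N K : Subgroup H) [N.FiniteIndex]
    [Infinite (H ⧸ K)] {T : Set H} (hT : T.Finite) : ∃ h ∈ N, ∀ t ∈ T, h * t⁻¹ ∉ K := by
  by_contra! hcon
  have := hT.to_subtype
  -- If the cosets `K * t` covered `N`, then `g * n * t⁻¹` would represent `g` in `H ⧸ K`, with `g *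
  -- n` the chosen representative of the coset of `g` modulo `N`.
  have hsurj : Function.Surjective (fun x : (H ⧸ N) × T =>
      (QuotientGroup.mk (x.1.out * (x.2 : H)⁻¹) : H ⧸ K)) := by
    rintro ⟨g⟩
    obtain ⟨n, hn⟩ := QuotientGroup.mk_out_eq_mul N g
    obtain ⟨t, ht, hK⟩ := hcon n n.2
    refine ⟨⟨g, t, ht⟩, QuotientGroup.eq.2 ?_⟩
    simpa [hn, mul_assoc] using K.inv_mem hK
  have := Finite.of_surjective _ hsurj
  exact not_finite (H ⧸ K)

/-- A finite set joining the two rays is pushed off `D` by an element fixing all ends, which brings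
each ray back to its own component. -/
theorem joined_of_rays {H V : Type*} [Group H] [MulAction H V] (J : Connectivity H V)
    (free : ∀ (h : H) (v : V), h • v = v → h = 1) {A : ℕ → Set V} (hA : CofiniteExhaustion H A)
    [Finite (J.Ends A)] (K : Subgroup H) [Infinite (H ⧸ K)] {D F : Set V} (hF : F.Finite)
    (hDF : ∀ v ∈ D, ∃ f ∈ F, ∃ k ∈ K, v = k • f) {m : ℕ} (hm : D ⊆ A m) {r s : ℕ → V}
    (hr : J.IsRay A r) (hs : J.IsRay A s) : J.joined Dᶜ (r m) (s m) := by
  obtain ⟨N, hN, hNr⟩ := J.exists_finiteIndex_fixing hA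
  obtain ⟨P, hP, hPJ⟩ := J.exists_finite (r m) (s m)
  have hT : {h : H | ∃ p ∈ P, ∃ f ∈ F, h • p = f}.Finite := by
    have : {h : H | ∃ p ∈ P, ∃ f ∈ F, h • p = f} = ⋃ p ∈ P, ⋃ f ∈ F, {h : H | h • p = f} := by
      ext; simp
    rw [this]
    refine hP.biUnion fun p _ => hF.biUnion fun f _ => Set.Subsingleton.finite ?_
    intro h hh h' hh'
    have : h⁻¹ * h' = 1 := free _ p (by
      rw [mul_smul, show h' • p = f from hh', ← show h • p = f from hh, inv_smul_smul])
    exact inv_mul_eq_one.1 this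
  obtain ⟨h, hh, hhT⟩ := exists_mem_forall_mul_inv_notMem N K hT
  have hPD : h • P ⊆ Dᶜ := by
    rintro _ ⟨p, hp, rfl⟩ hpD
    obtain ⟨f, hf, k, hk, e⟩ := hDF _ hpD
    refine hhT (k⁻¹ * h) ⟨p, hp, f, hf, ?_⟩ (by simpa using hk)
    rw [mul_smul, show h • p = k • f from e, inv_smul_smul]
  have hmono := J.mono (v := h • r m) (w := r m) (Set.compl_subset_compl.2 hm) (hNr h hh r hr m)
  have hmono' := J.mono (v := h • s m) (w := s m) (Set.compl_subset_compl.2 hm) (hNr h hh s hs m)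
  exact J.trans (J.symm hmono) (J.trans (J.mono hPD (J.smul h hPJ)) hmono')

/-- The ends of an exhaustion by `K`-cofinite sets, for a subgroup `K` of infinite index of a group
for which there are finitely many ends, but at least one. -/
theorem exists_unique_ray {H V : Type*} [Group H] [MulAction H V] (J : Connectivity H V)
    (free : ∀ (h : H) (v : V), h • v = v → h = 1) {A : ℕ → Set V} (hA : CofiniteExhaustion H A)
    [Finite (J.Ends A)] [Nonempty (J.Ends A)] (K : Subgroup H) [Infinite (H ⧸ K)] {D : ℕ → Set V}
    (hD : CofiniteExhaustion K D) :
    ∃ r, J.IsRay D r ∧ ∀ c, J.IsRay D c → ∀ n, J.joined (D n)ᶜ (c n) (r n) := by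
  obtain ⟨⟨r₀, hr₀⟩⟩ := ‹Nonempty (J.Ends A)›
  choose F hF hDF using hD.finite
  have hDF' : ∀ n, ∀ v ∈ D n, ∃ f ∈ F n, ∃ k ∈ K, v = k • f := by
    intro n v hv
    obtain ⟨f, hf, k, rfl⟩ := hDF n v hv
    exact ⟨f, hf, k, k.2, rfl⟩
  have hDA : ∀ n, ∃ m, D n ⊆ A m := by
    intro n
    obtain ⟨m, hm⟩ := hA.exists_finite_subset (hF n)
    refine ⟨m, fun v hv => ?_⟩
    obtain ⟨f, hf, k, -, rfl⟩ := hDF' n v hv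
    exact hA.smul_mem k (hm hf)
  choose M hM using hDA
  -- Reindexing by `M` turns an `A`-ray into a `D`-ray, since `D n ⊆ A (M n)`.
  refine ⟨fun n => r₀ (M n), fun n => hr₀.joined_of_subset hA.mono (hM n)
    ((hD.mono n.le_succ).trans (hM _)), fun c hc n => ?_⟩
  by_contra hn
  have hno : ∀ w, J.joined (D n)ᶜ (c n) w → ∀ r, J.IsRay A r → ¬ J.joined (D n)ᶜ w (r (M n)) :=
    fun w hw r hr hwr => hn (J.trans hw (J.trans hwr
      (joined_of_rays J free hA K (hF n) (hDF' n) (hM n) hr hr₀)))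
  obtain ⟨k, hk⟩ := J.exists_unbounded hA (M n)
  have hWk : ∀ w, J.joined (D n)ᶜ (c n) w → w ∈ A k := by
    intro w hw
    by_contra hwk
    obtain ⟨r, hr, rfl⟩ := (hk w hwk).exists_ray hA
    exact hno _ hw r hr (J.refl (J.right_mem hw))
  obtain ⟨F', hF', hAF'⟩ := hA.finite k
  choose P hP hPJ using fun f => J.exists_finite f (r₀ (M n))
  -- By freeness all `h` with `h • p` in `K • d` form at most one coset `K * h₀`, so the points `h •
  -- f` lie in one `K`-orbit. If there is no such `h`, the index is irrelevant.
  have key : ∀ f p d : V, ∃ l, ∀ h : H, ∀ κ ∈ K, h • p = κ • d → h • f ∈ D l := by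
    intro f p d
    by_cases hex : ∃ h₀ : H, h₀ • p = d
    · obtain ⟨h₀, hh₀⟩ := hex
      obtain ⟨l, hl⟩ := hD.exhaust (h₀ • f)
      refine ⟨l, fun h κ hκ e => ?_⟩
      have : (κ * h₀)⁻¹ * h = 1 := free _ p (by
        rw [mul_smul, e, ← hh₀, ← mul_smul κ, inv_smul_smul])
      rw [← inv_mul_eq_one.1 this, mul_smul]
      exact hD.smul_mem ⟨κ, hκ⟩ hl
    · refine ⟨0, fun h κ hκ e => (hex ⟨κ⁻¹ * h, ?_⟩).elim⟩
      rw [mul_smul, e, inv_smul_smul]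
  choose l hl using key
  have hfin : {x | ∃ f ∈ F', ∃ p ∈ P f, ∃ d ∈ F n, l f p d = x}.Finite := by
    have : {x | ∃ f ∈ F', ∃ p ∈ P f, ∃ d ∈ F n, l f p d = x} =
        ⋃ f ∈ F', ⋃ p ∈ P f, ⋃ d ∈ F n, {l f p d} := by
      ext; simp [eq_comm]
    rw [this]
    exact hF'.biUnion fun f _ => (hP f).biUnion fun p _ => (hF n).biUnion fun d _ =>
      Set.finite_singleton _
  obtain ⟨B, hB⟩ := hfin.bddAbove
  have hWB : ∀ w, J.joined (D n)ᶜ (c n) w → w ∈ D B := by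
    intro w hw
    obtain ⟨f, hf, h, rfl⟩ := hAF' w (hWk w hw)
    -- Otherwise `w` would be joined outside `D n` to the translated `A`-ray `h • r₀`.
    have hmeet : ¬ h • P f ⊆ (D n)ᶜ := fun hsub =>
      hno _ hw _ (hr₀.smul hA h) (J.mono hsub (J.smul h (hPJ f)))
    obtain ⟨_, ⟨p, hp, rfl⟩, hpD⟩ := Set.not_subset.1 hmeet
    obtain ⟨d, hd, κ, hκ, e⟩ := hDF' n _ (not_not.1 hpD)
    exact hD.mono (hB ⟨f, hf, p, hp, d, hd, rfl⟩) (hl f p d h κ hκ e)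
  have h1 := J.mono (Set.compl_subset_compl.2 subset_rfl)
    (hc.joined_of_le hD.mono (le_max_left n B))
  exact hc.mem (max n B) (hD.mono (le_max_right n B) (hWB _ h1))

/-! ### Subcomplexes, vertices and full subcomplexes -/

section Subsets

variable {Y : Type*} [TopologicalSpace Y] [CWComplex (Set.univ : Set Y)]

/-- The underlying sets of subcomplexes: every open cell met is contained together with its
closure. -/
def IsSub (E : Set Y) : Prop :=
  ∀ (n : ℕ) (i : cell (Set.univ : Set Y) n), ∀ y ∈ openCell n i, y ∈ E → closedCell n i ⊆ E

theorem exists_mem_openCell (y : Y) : ∃ (n : ℕ) (i : cell (Set.univ : Set Y) n),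
    y ∈ openCell n i := by
  have h : y ∈ (Set.univ : Set Y) := Set.mem_univ y
  rw [← CWComplex.iUnion_openCell_eq_complex (C := (Set.univ : Set Y))] at h
  simpa only [Set.mem_iUnion] using h

theorem cell_eq_of_mem_openCell {n m : ℕ} {i : cell (Set.univ : Set Y) n}
    {j : cell (Set.univ : Set Y) m} {y : Y} (hi : y ∈ openCell n i) (hj : y ∈ openCell m j) :
    (⟨n, i⟩ : Σ n, cell (Set.univ : Set Y) n) = ⟨m, j⟩ := by
  by_contra hne
  exact Set.disjoint_left.1 (disjoint_openCell_of_ne hne) hi hj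

theorem isSub_iUnion {ι : Sort*} {E : ι → Set Y} (h : ∀ k, IsSub (E k)) : IsSub (⋃ k, E k) := by
  intro n i y hy hyE
  obtain ⟨k, hk⟩ := Set.mem_iUnion.1 hyE
  exact (h k n i y hy hk).trans (Set.subset_iUnion E k)

theorem IsSub.inter {E F : Set Y} (hE : IsSub E) (hF : IsSub F) : IsSub (E ∩ F) :=
  fun n i y hy h => Set.subset_inter (hE n i y hy h.1) (hF n i y hy h.2)

theorem IsSub.union_closedCell {E : Set Y} (hE : IsSub E) {n : ℕ}
    {i : cell (Set.univ : Set Y) n} (h : cellFrontier n i ⊆ E) : IsSub (E ∪ closedCell n i) := by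
  rintro m j y hy (hyE | hyi)
  · exact (hE m j y hy hyE).trans Set.subset_union_left
  · rw [← cellFrontier_union_openCell_eq_closedCell] at hyi
    rcases hyi with hyi | hyi
    · exact (hE m j y hy (h hyi)).trans Set.subset_union_left
    · cases cell_eq_of_mem_openCell hy hyi
      exact Set.subset_union_right

theorem openCell_subset_union_of_frontier {E : Set Y} {n : ℕ} {i : cell (Set.univ : Set Y) n}
    (h : cellFrontier n i ⊆ E) : E ∪ closedCell n i ⊆ E ∪ openCell n i := by
  rw [← cellFrontier_union_openCell_eq_closedCell]
  exact Set.union_subset Set.subset_union_left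
    (Set.union_subset (h.trans Set.subset_union_left) Set.subset_union_right)

/-- The points that are `0`-cells. -/
def vertexSet (Y : Type*) [TopologicalSpace Y] [CWComplex (Set.univ : Set Y)] : Set Y :=
  {y | ∃ i : cell (Set.univ : Set Y) 0, y ∈ openCell 0 i}

theorem eq_of_mem_zero_cell {i : cell (Set.univ : Set Y) 0} {x y : Y} (hx : x ∈ openCell 0 i)
    (hy : y ∈ openCell 0 i) : x = y := by
  rw [RelCWComplex.openCell_zero_eq_singleton] at hx hy
  rw [Set.mem_singleton_iff.1 hx, Set.mem_singleton_iff.1 hy]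

theorem dim_eq_zero_of_mem {y : Y} (hy : y ∈ vertexSet Y) {n : ℕ}
    {i : cell (Set.univ : Set Y) n} (hi : y ∈ openCell n i) : n = 0 := by
  obtain ⟨j, hj⟩ := hy
  exact congrArg Sigma.fst (cell_eq_of_mem_openCell hi hj)

theorem isSub_vertex {y : Y} (hy : y ∈ vertexSet Y) : IsSub {y} := by
  rintro n i z hz rfl
  obtain rfl := dim_eq_zero_of_mem hy hz
  intro w hw
  rw [RelCWComplex.openCell_zero_eq_singleton] at hz
  rw [RelCWComplex.closedCell_zero_eq_singleton] at hw
  rw [Set.mem_singleton_iff.1 hz, Set.mem_singleton_iff.1 hw, Set.mem_singleton_iff]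

theorem exists_lower_cell {n : ℕ} (hn : n ≠ 0) (i : cell (Set.univ : Set Y) n) :
    ∃ m < n, ∃ (j : cell (Set.univ : Set Y) m), ∃ y ∈ openCell m j, y ∈ cellFrontier n i := by
  obtain ⟨I, hI⟩ := CWComplex.cellFrontier_subset_finite_openCell n i
  obtain ⟨y, hy⟩ := RelCWComplex.nonempty_cellFrontier hn i
  have h := hI hy
  simp only [Set.mem_iUnion] at h
  obtain ⟨m, hm, j, -, hyj⟩ := h
  exact ⟨m, hm, j, y, hyj, hy⟩

theorem isPathConnected_closedCell (n : ℕ) (i : cell (Set.univ : Set Y) n) :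
    IsPathConnected (closedCell n i) :=
  IsPathConnected.image' ((convex_closedBall _ _).isPathConnected
    ⟨0, Metric.mem_closedBall_self zero_le_one⟩) (continuousOn n i)

/-- Every point of a subcomplex is joined in it to a vertex. -/
theorem IsSub.exists_joinedIn_vertex {E : Set Y} (hE : IsSub E) {x : Y} (hx : x ∈ E) :
    ∃ v : vertexSet Y, JoinedIn E x v := by
  obtain ⟨n, i, hi⟩ := exists_mem_openCell x
  induction n using Nat.strong_induction_on generalizing x with
  | _ n ih =>
    rcases eq_or_ne n 0 with rfl | hn
    · exact ⟨⟨x, i, hi⟩, JoinedIn.refl hx⟩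
    · obtain ⟨m, hm, j, y, hyj, hyi⟩ := exists_lower_cell hn i
      have hsub := hE n i x hi hx
      have hyi' := cellFrontier_subset_closedCell n i hyi
      obtain ⟨v, hv⟩ := ih m hm (hsub hyi') j hyj
      exact ⟨v, (((isPathConnected_closedCell n i).joinedIn x
        (openCell_subset_closedCell n i hi) y hyi').mono hsub).trans hv⟩

/-- The largest subcomplex all of whose vertices lie in a given set. -/
def fullSet (S : Set (vertexSet Y)) : Set Y :=
  ⋃ E : {E : Set Y // IsSub E ∧ ∀ v : vertexSet Y, (v : Y) ∈ E → v ∈ S}, (E : Set Y)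

theorem isSub_fullSet (S : Set (vertexSet Y)) : IsSub (fullSet S) :=
  isSub_iUnion fun E => E.2.1

theorem subset_fullSet {S : Set (vertexSet Y)} {E : Set Y} (hE : IsSub E)
    (h : ∀ v : vertexSet Y, (v : Y) ∈ E → v ∈ S) : E ⊆ fullSet S :=
  Set.subset_iUnion_of_subset ⟨E, hE, h⟩ subset_rfl

theorem mem_fullSet_iff {S : Set (vertexSet Y)} {v : vertexSet Y} :
    (v : Y) ∈ fullSet S ↔ v ∈ S := by
  constructor
  · intro h
    obtain ⟨E, hE⟩ := Set.mem_iUnion.1 h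
    exact E.2.2 v hE
  · intro h
    refine subset_fullSet (isSub_vertex v.2) (fun w hw => ?_) rfl
    rwa [Subtype.ext hw]

theorem fullSet_mono {S T : Set (vertexSet Y)} (h : S ⊆ T) : fullSet S ⊆ fullSet T :=
  subset_fullSet (isSub_fullSet S) fun _ hv => h (mem_fullSet_iff.1 hv)

/-- The intersection is a subcomplex, so a common point would be joined in it to a common vertex. -/
theorem disjoint_fullSet {S T : Set (vertexSet Y)} (h : Disjoint S T) :
    Disjoint (fullSet S) (fullSet T) := by
  rw [Set.disjoint_left]
  intro x hxS hxT
  obtain ⟨v, hv⟩ := ((isSub_fullSet S).inter (isSub_fullSet T)).exists_joinedIn_vertex ⟨hxS, hxT⟩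
  exact Set.disjoint_left.1 h (mem_fullSet_iff.1 hv.target_mem.1)
    (mem_fullSet_iff.1 hv.target_mem.2)

theorem closedCell_subset_fullSet {S : Set (vertexSet Y)} {n : ℕ} (hn : n ≠ 0)
    {i : cell (Set.univ : Set Y) n} (h : cellFrontier n i ⊆ fullSet S) :
    closedCell n i ⊆ fullSet S := by
  refine Set.subset_union_right.trans
    (subset_fullSet ((isSub_fullSet S).union_closedCell h) fun v hv => ?_)
  rcases openCell_subset_union_of_frontier h hv with hv | hv
  · exact mem_fullSet_iff.1 hv
  · exact absurd (dim_eq_zero_of_mem v.2 hv) hn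

/-- Vertices lying in a common closed `1`-cell. -/
def Adjacent (u v : vertexSet Y) : Prop :=
  ∃ i : cell (Set.univ : Set Y) 1, (u : Y) ∈ closedCell 1 i ∧ (v : Y) ∈ closedCell 1 i

theorem cellFrontier_one_eq_pair (i : cell (Set.univ : Set Y) 1) :
    ∃ u v : vertexSet Y, cellFrontier 1 i = {(u : Y), (v : Y)} := by
  obtain ⟨a, b, h⟩ := CWComplex.exists_cellFrontier_one_eq i
  refine ⟨⟨_, a, RelCWComplex.map_zero_mem_openCell 0 a⟩,
    ⟨_, b, RelCWComplex.map_zero_mem_openCell 0 b⟩, ?_⟩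
  rw [h, RelCWComplex.closedCell_zero_eq_singleton, RelCWComplex.closedCell_zero_eq_singleton,
    Set.singleton_union]
  congr! 3

theorem mem_cellFrontier_of_vertex {v : vertexSet Y} {n : ℕ} (hn : n ≠ 0)
    {i : cell (Set.univ : Set Y) n} (hv : (v : Y) ∈ closedCell n i) :
    (v : Y) ∈ cellFrontier n i := by
  rw [← cellFrontier_union_openCell_eq_closedCell] at hv
  exact hv.resolve_right fun h => hn (dim_eq_zero_of_mem v.2 h)

theorem Adjacent.joinedIn {u v : vertexSet Y} (h : Adjacent u v) {S : Set (vertexSet Y)}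
    (hu : u ∈ S) (hv : v ∈ S) : JoinedIn (fullSet S) (u : Y) v := by
  obtain ⟨i, hui, hvi⟩ := h
  -- When the vertices coincide, the other endpoint of the `1`-cell may lie outside `S`, so the cell
  -- itself cannot be used.
  by_cases huv : u = v
  · subst huv
    exact JoinedIn.refl (mem_fullSet_iff.2 hu)
  refine ((isPathConnected_closedCell 1 i).joinedIn _ hui _ hvi).mono
    (closedCell_subset_fullSet one_ne_zero ?_)
  obtain ⟨a, b, hab⟩ := cellFrontier_one_eq_pair i
  have h1 := mem_cellFrontier_of_vertex one_ne_zero hui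
  have h2 := mem_cellFrontier_of_vertex one_ne_zero hvi
  simp only [hab, Set.mem_insert_iff, Set.mem_singleton_iff, Subtype.coe_inj] at h1 h2
  have : a ∈ S ∧ b ∈ S := by
    rcases h1 with rfl | rfl <;> rcases h2 with rfl | rfl
    · exact absurd rfl huv
    · exact ⟨hu, hv⟩
    · exact ⟨hv, hu⟩
    · exact absurd rfl huv
  rw [hab, Set.pair_subset_iff, mem_fullSet_iff, mem_fullSet_iff]
  exact this

theorem isPreconnected_cellFrontier {n : ℕ} (hn : 2 ≤ n) (i : cell (Set.univ : Set Y) n) :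
    IsPreconnected (cellFrontier n i) := by
  refine (isPreconnected_sphere ?_ 0 1).image _
    ((continuousOn n i).mono Metric.sphere_subset_closedBall)
  rw [rank_fin_fun]
  exact_mod_cast hn

theorem mem_of_mem_openCell (E : Subcomplex (Set.univ : Set Y)) {n : ℕ}
    {i : cell (Set.univ : Set Y) n} {y : Y} (hi : y ∈ openCell n i) (hy : y ∈ (E : Set Y)) :
    i ∈ E.I n := by
  by_contra h
  exact Set.disjoint_left.1 (CWComplex.Subcomplex.disjoint_openCell_subcomplex_of_not_mem E h)
    hi hy

section T2

variable [T2Space Y]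

/-- The subcomplex with a given underlying set. -/
def IsSub.toSubcomplex {E : Set Y} (hE : IsSub E) : Subcomplex (Set.univ : Set Y) :=
  CWComplex.Subcomplex.mk' Set.univ E (fun n => {i | closedCell n i ⊆ E}) (fun _ i => i.2) (by
    refine Set.Subset.antisymm (Set.iUnion₂_subset fun n i =>
      (openCell_subset_closedCell n _).trans i.2) fun y hy => ?_
    obtain ⟨n, i, hi⟩ := exists_mem_openCell y
    exact Set.mem_iUnion₂.2 ⟨n, ⟨i, hE n i y hi hy⟩, hi⟩)

@[simp]
theorem IsSub.coe_toSubcomplex {E : Set Y} (hE : IsSub E) : (hE.toSubcomplex : Set Y) = E := rfl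

theorem isSub_coe (E : Subcomplex (Set.univ : Set Y)) : IsSub (E : Set Y) :=
  fun _ _ _ hi hy =>
    CWComplex.Subcomplex.closedCell_subset_of_mem E (mem_of_mem_openCell E hi hy)

theorem IsSub.isClosed {E : Set Y} (hE : IsSub E) : IsClosed E := hE.toSubcomplex.closed'

theorem cwCompl_eq_fullSet (A : Subcomplex (Set.univ : Set Y)) :
    (cwCompl A : Set Y) = fullSet {v : vertexSet Y | (v : Y) ∈ (A : Set Y)}ᶜ := by
  refine Set.Subset.antisymm (Set.iUnion₂_subset fun E hE => subset_fullSet (isSub_coe E) ?_) ?_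
  · rintro ⟨v, i, hi⟩ hv hA
    exact Set.disjoint_left.1 hE (mem_of_mem_openCell E hi hv) (mem_of_mem_openCell A hi hA)
  · refine Set.subset_iUnion₂_of_subset (isSub_fullSet _).toSubcomplex ?_ subset_rfl
    refine Set.disjoint_left.2 fun i hi hA => ?_
    have h0 := RelCWComplex.map_zero_mem_openCell 0 i
    have h1 := (CWComplex.Subcomplex.openCell_subset_of_mem _ hi) h0
    rw [IsSub.coe_toSubcomplex] at h1
    exact (mem_fullSet_iff (v := ⟨_, i, h0⟩)).1 h1
      (CWComplex.Subcomplex.openCell_subset_of_mem A hA h0)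

/-- By induction on dimension no cell straddles the two sides: adjacency handles `1`-cells, and from
dimension two on the boundary is connected while the two sides are disjoint and closed. -/
theorem fullSet_union_fullSet_compl {T : Set (vertexSet Y)}
    (hT : ∀ u ∈ T, ∀ v, Adjacent u v → v ∈ T) : fullSet T ∪ fullSet Tᶜ = Set.univ := by
  have key : ∀ n (i : cell (Set.univ : Set Y) n),
      closedCell n i ⊆ fullSet T ∨ closedCell n i ⊆ fullSet Tᶜ := by
    intro n
    induction n using Nat.strong_induction_on with
    | _ n ih =>
      intro i
      rcases eq_or_ne n 0 with rfl | hn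
      · let v : vertexSet Y := ⟨_, i, RelCWComplex.map_zero_mem_openCell 0 i⟩
        have hv : ∀ S, v ∈ S → closedCell 0 i ⊆ fullSet S := by
          intro S hvS
          exact isSub_fullSet S 0 i v (RelCWComplex.map_zero_mem_openCell 0 i)
            (mem_fullSet_iff.2 hvS)
        exact (em (v ∈ T)).imp (hv T) (hv Tᶜ)
      · suffices cellFrontier n i ⊆ fullSet T ∨ cellFrontier n i ⊆ fullSet Tᶜ from
          this.imp (closedCell_subset_fullSet hn) (closedCell_subset_fullSet hn)
        rcases (show n = 1 ∨ 2 ≤ n by omega) with rfl | h2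
        · obtain ⟨a, b, hab⟩ := cellFrontier_one_eq_pair i
          have ha : (a : Y) ∈ closedCell 1 i :=
            cellFrontier_subset_closedCell 1 i (by simp [hab])
          have hb : (b : Y) ∈ closedCell 1 i :=
            cellFrontier_subset_closedCell 1 i (by simp [hab])
          simp only [hab, Set.pair_subset_iff, mem_fullSet_iff, Set.mem_compl_iff]
          have h1 : a ∈ T → b ∈ T := fun h => hT a h b ⟨i, ha, hb⟩
          have h2 : b ∈ T → a ∈ T := fun h => hT b h a ⟨i, hb, ha⟩
          tauto
        · have hcov : cellFrontier n i ⊆ fullSet T ∪ fullSet Tᶜ := by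
            obtain ⟨I, hI⟩ := CWComplex.cellFrontier_subset_finite_closedCell n i
            refine hI.trans (Set.iUnion₂_subset fun m hm => Set.iUnion₂_subset fun j _ => ?_)
            exact (ih m hm j).elim (fun h => h.trans Set.subset_union_left)
              (fun h => h.trans Set.subset_union_right)
          refine (isPreconnected_iff_subset_of_disjoint_closed.1
            (isPreconnected_cellFrontier h2 i)) _ _ (isSub_fullSet T).isClosed
            (isSub_fullSet Tᶜ).isClosed hcov ?_
          rw [(disjoint_fullSet disjoint_compl_right).inter_eq, Set.inter_empty]
  refine Set.eq_univ_of_forall fun y => ?_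
  obtain ⟨n, i, hi⟩ := exists_mem_openCell y
  have hy := openCell_subset_closedCell n i hi
  exact (key n i).imp (fun h => h hy) (fun h => h hy)

/-- In a connected complex, a nonempty set of vertices closed under adjacency contains all
vertices. -/
theorem eq_univ_of_adjacent_closed [ConnectedSpace Y] {T : Set (vertexSet Y)}
    (hT : ∀ u ∈ T, ∀ v, Adjacent u v → v ∈ T) (hne : T.Nonempty) : T = Set.univ := by
  have hcov := fullSet_union_fullSet_compl hT
  have hdis := disjoint_fullSet (disjoint_compl_right (a := T))
  have hc : fullSet Tᶜ = (fullSet T)ᶜ := by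
    refine Set.Subset.antisymm hdis.symm.subset_compl_right fun y hy => ?_
    exact ((Set.ext_iff.1 hcov y).2 trivial).resolve_left hy
  have hclopen : IsClopen (fullSet T) :=
    ⟨(isSub_fullSet T).isClosed, by
      rw [← isClosed_compl_iff, ← hc]; exact (isSub_fullSet _).isClosed⟩
  rcases isClopen_iff.1 hclopen with h | h
  · obtain ⟨v, hv⟩ := hne
    exact absurd (h ▸ mem_fullSet_iff.2 hv) (Set.notMem_empty _)
  · refine Set.eq_univ_of_forall fun v => mem_fullSet_iff.1 ?_
    rw [h]; trivial

end T2

end Subsets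

/-! ### Local finiteness and countability -/

section LocallyFinite

variable {Y : Type*} [TopologicalSpace Y] [T2Space Y] [CWComplex (Set.univ : Set Y)]

theorem finite_cells_meeting (hY : IsLocallyFiniteType (Set.univ : Set Y)) {m n : ℕ} (hmn : m ≤ n)
    (i : cell (Set.univ : Set Y) m) :
    {j : cell (Set.univ : Set Y) n | (closedCell m i ∩ closedCell n j).Nonempty}.Finite := by
  have hmem : ∀ k ≤ n, ∀ j : cell (Set.univ : Set Y) k,
      j ∈ (skeleton (Set.univ : Set Y) (n : ℕ∞)).I k := fun k hk j =>
    mem_of_mem_openCell _ (RelCWComplex.map_zero_mem_openCell k j)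
      (RelCWComplex.skeleton_mono (by exact_mod_cast hk)
        (openCell_subset_skeleton k j (RelCWComplex.map_zero_mem_openCell k j)))
  let f : cell (Set.univ : Set Y) n →
      Σ k, cell (skeleton (Set.univ : Set Y) (n : ℕ∞) : Set Y) k :=
    fun j => ⟨n, ⟨j, hmem n le_rfl j⟩⟩
  have hf : Function.Injective f := fun j j' h =>
    congrArg Subtype.val (eq_of_heq (Sigma.mk.inj_iff.1 h).2)
  exact Set.Finite.preimage (f := f) hf.injOn (hY n m ⟨i, hmem m hmn i⟩)

theorem finite_adjacent (hY : IsLocallyFiniteType (Set.univ : Set Y)) (v : vertexSet Y) :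
    {u : vertexSet Y | Adjacent v u}.Finite := by
  obtain ⟨v, i, hi⟩ := v
  have h1 := finite_cells_meeting hY zero_le_one i
  refine (h1.biUnion (t := fun j => {u : vertexSet Y | (u : Y) ∈ closedCell 1 j})
    fun j _ => ?_).subset ?_
  · obtain ⟨a, b, hab⟩ := cellFrontier_one_eq_pair j
    refine (Set.toFinite {a, b}).subset fun u hu => ?_
    have h2 := mem_cellFrontier_of_vertex one_ne_zero hu
    simpa only [hab, Set.mem_insert_iff, Set.mem_singleton_iff, Subtype.coe_inj] using h2
  · rintro u ⟨j, hvj, huj⟩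
    exact Set.mem_iUnion₂.2 ⟨j, ⟨v, openCell_subset_closedCell 0 i hi, hvj⟩, huj⟩

theorem countable_vertexSet (hY : IsLocallyFiniteType (Set.univ : Set Y)) [ConnectedSpace Y] :
    Countable (vertexSet Y) := by
  rcases isEmpty_or_nonempty (vertexSet Y) with h | ⟨⟨v⟩⟩
  · infer_instance
  let B : ℕ → Set (vertexSet Y) := fun k =>
    Nat.rec {v} (fun _ S => ⋃ u ∈ S, {w | Adjacent u w}) k
  have hB : ∀ k, (B k).Countable := by
    intro k
    induction k with
    | zero => exact Set.countable_singleton v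
    | succ k ih => exact ih.biUnion fun u _ => (finite_adjacent hY u).countable
  have huniv : (⋃ k, B k) = Set.univ := by
    refine eq_univ_of_adjacent_closed (fun u hu w huw => ?_) ⟨v, Set.mem_iUnion.2 ⟨0, rfl⟩⟩
    obtain ⟨k, hk⟩ := Set.mem_iUnion.1 hu
    exact Set.mem_iUnion.2 ⟨k + 1, Set.mem_iUnion₂.2 ⟨u, hk, huw⟩⟩
  rw [← Set.countable_univ_iff, ← huniv]
  exact Set.countable_iUnion hB

/-- Each cell of positive dimension meets a cell of lower dimension, and each of those meets
finitely many cells of a given higher dimension. -/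
theorem countable_cell (hY : IsLocallyFiniteType (Set.univ : Set Y)) [ConnectedSpace Y] (n : ℕ) :
    Countable (cell (Set.univ : Set Y) n) := by
  induction n using Nat.strong_induction_on with
  | _ n ih =>
    rcases eq_or_ne n 0 with rfl | hn
    · have := countable_vertexSet hY
      refine Function.Injective.countable (β := vertexSet Y)
        (f := fun i => ⟨_, i, RelCWComplex.map_zero_mem_openCell 0 i⟩) fun i j h => ?_
      have hj := RelCWComplex.map_zero_mem_openCell 0 j
      have hij : map 0 i 0 = map 0 j 0 := congrArg Subtype.val h
      rw [← hij] at hj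
      exact eq_of_heq (Sigma.mk.inj_iff.1
        (cell_eq_of_mem_openCell (RelCWComplex.map_zero_mem_openCell 0 i) hj)).2
    · rw [← Set.countable_univ_iff]
      have : (Set.univ : Set (cell (Set.univ : Set Y) n)) ⊆ ⋃ m ∈ {m | m < n},
          ⋃ j : cell (Set.univ : Set Y) m,
            {i | (closedCell m j ∩ closedCell n i).Nonempty} := by
        intro i _
        obtain ⟨m, hm, j, y, hyj, hyi⟩ := exists_lower_cell hn i
        exact Set.mem_iUnion₂.2 ⟨m, hm, Set.mem_iUnion.2 ⟨j, y,
          openCell_subset_closedCell m j hyj, cellFrontier_subset_closedCell n i hyi⟩⟩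
      refine Set.Countable.mono this ((Set.to_countable _).biUnion fun m hm => ?_)
      have := ih m hm
      exact Set.countable_iUnion fun j => (finite_cells_meeting hY (le_of_lt hm) j).countable

end LocallyFinite

/-! ### Finite subcomplexes -/

section FiniteHull

variable {Y : Type*} [TopologicalSpace Y] [CWComplex (Set.univ : Set Y)]

/-- The cells whose interior meets a set. -/
def cellsMeeting (E : Set Y) : Set (Σ n, cell (Set.univ : Set Y) n) :=
  {d | ∃ y ∈ openCell d.1 d.2, y ∈ E}

/-- Every closed cell is contained in a finite subcomplex. -/
theorem exists_finite_hull (n : ℕ) (i : cell (Set.univ : Set Y) n) :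
    ∃ E : Set Y, IsSub E ∧ closedCell n i ⊆ E ∧ (cellsMeeting E).Finite := by
  induction n using Nat.strong_induction_on with
  | _ n ih =>
    obtain ⟨I, hI⟩ := CWComplex.cellFrontier_subset_finite_closedCell n i
    choose! E hE hcE hfE using ih
    have hsub : cellFrontier n i ⊆ ⋃ m, ⋃ (_ : m < n), ⋃ j, ⋃ (_ : j ∈ I m), E m j := by
      refine hI.trans (Set.iUnion₂_mono fun m hm => Set.iUnion₂_mono fun j _ => hcE m hm j)
    refine ⟨_, IsSub.union_closedCell (isSub_iUnion fun m => isSub_iUnion fun hm =>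
      isSub_iUnion fun j => isSub_iUnion fun _ => hE m hm j) hsub, Set.subset_union_right, ?_⟩
    have hfin : (insert ⟨n, i⟩ (⋃ m ∈ {m | m < n}, ⋃ j ∈ (I m : Set _),
        cellsMeeting (E m j))).Finite :=
      Set.Finite.insert _ ((Set.finite_lt_nat n).biUnion fun m hm =>
        (I m).finite_toSet.biUnion fun j _ => hfE m hm j)
    refine hfin.subset ?_
    rintro d ⟨y, hyd, hy⟩
    rcases openCell_subset_union_of_frontier hsub hy with hy | hy
    · simp only [Set.mem_iUnion] at hy
      obtain ⟨m, hm, j, hj, hy⟩ := hy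
      exact Or.inr (Set.mem_iUnion₂.2 ⟨m, hm, Set.mem_iUnion₂.2 ⟨j, hj, y, hyd, hy⟩⟩)
    · exact Or.inl (cell_eq_of_mem_openCell hyd hy)

end FiniteHull

/-! ### Group action on vertices and filtrations of orbit spaces -/

section Action

variable {H Y : Type*} [Group H] [TopologicalSpace Y] [CWComplex (Set.univ : Set Y)]
  [MulAction H Y] [FreeGCW H Y]

theorem smul_mem_vertexSet (h : H) {v : Y} (hv : v ∈ vertexSet Y) : h • v ∈ vertexSet Y := by
  obtain ⟨i, hi⟩ := hv
  obtain ⟨j, hj⟩ := FreeGCW.smul_cell h 0 i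
  exact ⟨j, hj ▸ Set.smul_mem_smul_set hi⟩

instance vertexAction : MulAction H (vertexSet Y) where
  smul h v := ⟨h • (v : Y), smul_mem_vertexSet h v.2⟩
  one_smul v := Subtype.ext (one_smul H (v : Y))
  mul_smul g h v := Subtype.ext (mul_smul g h (v : Y))

theorem eq_one_of_smul_vertex {h : H} {v : vertexSet Y} (hv : h • v = v) : h = 1 := by
  obtain ⟨v, i, hi⟩ := v
  have h1 : h • v = v := congrArg Subtype.val hv
  exact eq_one_of_mem_openCell hi (h1.symm ▸ hi)

variable [T2Space Y]

theorem IsSub.smul {E : Set Y} (hE : IsSub E) (h : H) : IsSub (h • E) := by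
  intro n i y hy hyE
  obtain ⟨j, hj⟩ := FreeGCW.smul_cell h⁻¹ n i
  have h1 := hE n j (h⁻¹ • y) (hj ▸ Set.smul_mem_smul_set hy)
    (Set.mem_smul_set_iff_inv_smul_mem.1 hyE)
  rwa [← smul_closedCell hj, Set.smul_set_subset_iff_subset_inv_smul_set, inv_inv] at h1

theorem smul_fullSet_subset (h : H) (S : Set (vertexSet Y)) :
    h • fullSet S ⊆ fullSet (h • S) := by
  refine subset_fullSet ((isSub_fullSet S).smul h) fun v hv => ?_
  rw [Set.mem_smul_set_iff_inv_smul_mem] at hv ⊢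
  exact mem_fullSet_iff.1 hv

theorem Adjacent.smul {u v : vertexSet Y} (huv : Adjacent u v) (h : H) :
    Adjacent (h • u) (h • v) := by
  obtain ⟨i, hu, hv⟩ := huv
  obtain ⟨j, hj⟩ := FreeGCW.smul_cell h 1 i
  refine ⟨j, ?_, ?_⟩ <;> rw [← smul_closedCell hj] <;> exact Set.smul_mem_smul_set ‹_›

variable (H) in
/-- Vertices joined by a path in the full subcomplex on a set of vertices. -/
def vertexConnectivity [ConnectedSpace Y] (hY : IsLocallyFiniteType (Set.univ : Set Y)) :
    Connectivity H (vertexSet Y) where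
  joined S v w := JoinedIn (fullSet S) (v : Y) w
  nbhd v := {u | Adjacent v u}
  refl hv := JoinedIn.refl (mem_fullSet_iff.2 hv)
  left_mem h := mem_fullSet_iff.1 h.source_mem
  symm h := h.symm
  trans h h' := h.trans h'
  mono hST h := h.mono (fullSet_mono hST)
  smul h hvw := (hvw.map (FreeGCW.continuous_smul h)).mono (smul_fullSet_subset h _)
  exists_finite v w := by
    have hT : {w : vertexSet Y | ∃ P : Set (vertexSet Y), P.Finite ∧
        JoinedIn (fullSet P) (v : Y) w} = Set.univ := by
      refine eq_univ_of_adjacent_closed ?_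
        ⟨v, {v}, Set.finite_singleton v, JoinedIn.refl (mem_fullSet_iff.2 rfl)⟩
      rintro u ⟨P, hP, hPu⟩ x hux
      have hu := mem_fullSet_iff.1 hPu.target_mem
      exact ⟨insert x P, hP.insert x, (hPu.mono (fullSet_mono (Set.subset_insert x P))).trans
        (hux.joinedIn (Or.inr hu) (Or.inl rfl))⟩
    exact hT.symm.subset (Set.mem_univ w)
  finite_nbhd v := finite_adjacent hY v
  smul_nbhd h huv := huv.smul h
  exists_nbhd := by
    intro S v w hv hw
    by_contra! hcon
    -- A component of `S` with no vertex adjacent to the complement is closed under adjacency, hence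
    -- contains every vertex, including `w`.
    have hT : {u : vertexSet Y | JoinedIn (fullSet S) (v : Y) u} = Set.univ := by
      refine eq_univ_of_adjacent_closed ?_ ⟨v, JoinedIn.refl (mem_fullSet_iff.2 hv)⟩
      rintro u hu x ⟨i, hui, hxi⟩
      have hx : x ∈ S := by
        by_contra hx
        exact hcon u hu x hx ⟨i, hxi, hui⟩
      exact JoinedIn.trans hu
        (Adjacent.joinedIn ⟨i, hui, hxi⟩ (mem_fullSet_iff.1 hu.target_mem) hx)
    exact hw (mem_fullSet_iff.1 (hT.symm.subset (Set.mem_univ w)).target_mem)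

theorem openCell_quotient (n : ℕ) (c : QuotCell H Y n) :
    openCell (C := (Set.univ : Set (MulAction.orbitRel.Quotient H Y))) n c =
      orbitMap H '' openCell n c.out :=
  Set.image_comp (orbitMap H) (map n c.out) (Metric.ball 0 1)

theorem orbitMap_mem_openCell {n : ℕ} {i : cell (Set.univ : Set Y) n} {y : Y}
    (hy : y ∈ openCell n i) : orbitMap H y ∈
      openCell (C := (Set.univ : Set (MulAction.orbitRel.Quotient H Y))) n
        (Quotient.mk (cellSetoid H n) i) := by
  obtain ⟨g, hg⟩ := exists_smul_eq_out H n i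
  rw [openCell_quotient, ← hg, orbitMap_image_smul]
  exact ⟨y, hy, rfl⟩

/-- The vertices of the preimage of a finite filtration of the orbit space. -/
theorem cofiniteExhaustion_of_filtration {C : Filtration (MulAction.orbitRel.Quotient H Y)}
    (hC : C.IsFinite) {L : Filtration Y}
    (hL : ∀ n, (L.sub n : Set Y) = orbitMap H ⁻¹' (C.sub n : Set _)) :
    CofiniteExhaustion H (fun n => {v : vertexSet Y | (v : Y) ∈ (L.sub n : Set Y)}) where
  mono := monotone_nat_of_le_succ fun n _ hv => L.mono n hv
  exhaust v := by
    have hv : (v : Y) ∈ ⋃ n, (L.sub n : Set Y) := by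
      rw [L.exhaust]; trivial
    rw [Set.mem_iUnion] at hv
    exact hv
  smul_mem := by
    intro n v h hv
    have hv' : (v : Y) ∈ (L.sub n : Set Y) := hv
    change h • (v : Y) ∈ (L.sub n : Set Y)
    rw [hL] at hv' ⊢
    have e : orbitMap H (h • (v : Y)) = orbitMap H (v : Y) := (orbitMap_eq_iff H).2 ⟨h, rfl⟩
    rwa [Set.mem_preimage, e]
  finite := by
    intro n
    have := hC n
    let pt : ((C.sub n).I 0) → vertexSet Y := fun c =>
      ⟨_, (c : QuotCell H Y 0).out, RelCWComplex.map_zero_mem_openCell 0 _⟩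
    have hfin : Finite ((C.sub n).I 0) :=
      Finite.of_injective (fun c => (⟨0, c⟩ : Σ k, (C.sub n).I k))
        (sigma_mk_injective (β := fun k => (C.sub n).I k))
    refine ⟨Set.range pt, Set.finite_range pt, ?_⟩
    rintro ⟨v, i, hi⟩ hv
    have hv' : v ∈ (L.sub n : Set Y) := hv
    rw [hL] at hv'
    obtain ⟨g, hg⟩ := exists_smul_eq_out H 0 i
    refine ⟨_, ⟨⟨_, mem_of_mem_openCell (C.sub n) (orbitMap_mem_openCell hi) hv'⟩, rfl⟩, g⁻¹,
      eq_inv_smul_iff.2 (Subtype.ext ?_)⟩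
    exact eq_of_mem_zero_cell (hg ▸ Set.smul_mem_smul_set hi)
      (RelCWComplex.map_zero_mem_openCell 0 _)

/-- The image in the orbit space of an invariant subcomplex. -/
def IsSub.quotient {E : Set Y} (hE : IsSub E) (hH : orbitMap H ⁻¹' (orbitMap H '' E) = E) :
    Subcomplex (Set.univ : Set (MulAction.orbitRel.Quotient H Y)) where
  carrier := orbitMap H '' E
  I n := {c | closedCell n (Quotient.out (s := cellSetoid H n) c) ⊆ E}
  closed' := by
    rw [← (isQuotientMap_orbitMap H).isClosed_preimage, hH]
    exact hE.isClosed
  union' := by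
    rw [Set.empty_union]
    refine Set.Subset.antisymm (Set.iUnion₂_subset fun n c => ?_) ?_
    · rw [openCell_quotient]
      exact Set.image_mono ((openCell_subset_closedCell n _).trans c.2)
    · rintro _ ⟨y, hy, rfl⟩
      obtain ⟨n, i, hi⟩ := exists_mem_openCell y
      obtain ⟨g, hg⟩ := exists_smul_eq_out H n i
      refine Set.mem_iUnion₂.2 ⟨n, ⟨Quotient.mk (cellSetoid H n) i, ?_⟩, orbitMap_mem_openCell hi⟩
      refine hE n _ (g • y) (hg ▸ Set.smul_mem_smul_set hi) ?_
      rw [← hH]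
      exact ⟨y, hy, (orbitMap_eq_iff H).2 ⟨g⁻¹, by simp⟩⟩

theorem exists_finite_filtration [Nonempty Y] [Countable (Σ n, cell (Set.univ : Set Y) n)] :
    ∃ C : Filtration (MulAction.orbitRel.Quotient H Y), C.IsFinite ∧
      ∃ L : Filtration Y, ∀ n, (L.sub n : Set Y) = orbitMap H ⁻¹' (C.sub n : Set _) := by
  have hne : Nonempty (Σ n, cell (Set.univ : Set Y) n) := by
    obtain ⟨n, i, -⟩ := exists_mem_openCell (Classical.arbitrary Y)
    exact ⟨⟨n, i⟩⟩
  obtain ⟨f, hf⟩ := exists_surjective_nat (Σ n, cell (Set.univ : Set Y) n)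
  choose E hE hcE hfE using fun d : Σ n, cell (Set.univ : Set Y) n => exists_finite_hull d.1 d.2
  -- Saturate the finite hulls of the first `n + 1` cells of an enumeration; the quotient then has
  -- finitely many cells.
  let D : ℕ → Set Y := fun n => ⋃ k, ⋃ (_ : k ≤ n), ⋃ g : H, g • E (f k)
  have hD : ∀ n, IsSub (D n) := fun n => isSub_iUnion fun k => isSub_iUnion fun _ =>
    isSub_iUnion fun g => (hE (f k)).smul g
  have hmem : ∀ {n y}, y ∈ D n ↔ ∃ k ≤ n, ∃ g : H, y ∈ g • E (f k) := by
    intro n y; simp [D]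
  have hinv : ∀ n, orbitMap H ⁻¹' (orbitMap H '' D n) = D n := by
    intro n
    refine Set.Subset.antisymm ?_ (Set.subset_preimage_image _ _)
    rintro y ⟨x, hx, hxy⟩
    obtain ⟨h, rfl⟩ := (orbitMap_eq_iff H).1 hxy
    obtain ⟨k, hk, g, hg⟩ := hmem.1 hx
    refine hmem.2 ⟨k, hk, h⁻¹ * g, ?_⟩
    rw [mul_smul, Set.mem_smul_set_iff_inv_smul_mem, inv_inv]
    exact hg
  have hmono : ∀ n, D n ⊆ D (n + 1) := by
    intro n y hy
    obtain ⟨k, hk, h⟩ := hmem.1 hy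
    exact hmem.2 ⟨k, hk.trans n.le_succ, h⟩
  have hex : ⋃ n, D n = Set.univ := by
    refine Set.eq_univ_of_forall fun y => ?_
    obtain ⟨n, i, hi⟩ := exists_mem_openCell y
    obtain ⟨k, hk⟩ := hf ⟨n, i⟩
    refine Set.mem_iUnion.2 ⟨k, hmem.2 ⟨k, le_rfl, 1, ?_⟩⟩
    rw [one_smul, hk]
    exact hcE ⟨n, i⟩ (openCell_subset_closedCell n i hi)
  refine ⟨⟨fun n => (hD n).quotient (hinv n), fun n => Set.image_mono (hmono n), ?_⟩, fun n => ?_,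
    ⟨fun n => (hD n).toSubcomplex, hmono, hex⟩, fun n => (hinv n).symm⟩
  · change ⋃ n, orbitMap H '' D n = Set.univ
    rw [← Set.image_iUnion, hex, Set.image_univ]
    exact (isQuotientMap_orbitMap H).surjective.range_eq
  · have hfin : (⋃ k ∈ {k | k ≤ n}, (fun d : Σ m, cell (Set.univ : Set Y) m =>
        (⟨d.1, Quotient.mk (cellSetoid H d.1) d.2⟩ : Σ m, QuotCell H Y m)) ''
          cellsMeeting (E (f k))).Finite :=
      (Set.finite_le_nat n).biUnion fun k _ => (hfE (f k)).image _
    let T : Set (Σ m, QuotCell H Y m) := {d | d.2 ∈ ((hD n).quotient (hinv n)).I d.1}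
    have hT : T.Finite := by
      refine hfin.subset ?_
      rintro ⟨m, c⟩ hc
      have hy := RelCWComplex.map_zero_mem_openCell m (Quotient.out (s := cellSetoid H m) c)
      obtain ⟨k, hk, g, hg⟩ := hmem.1 (hc (openCell_subset_closedCell m _ hy))
      obtain ⟨j, hj⟩ := FreeGCW.smul_cell g⁻¹ m (Quotient.out (s := cellSetoid H m) c)
      refine Set.mem_biUnion (show k ∈ {k | k ≤ n} from hk)
        ⟨⟨m, j⟩, ⟨_, hj ▸ Set.smul_mem_smul_set hy, Set.mem_smul_set_iff_inv_smul_mem.1 hg⟩, ?_⟩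
      have : Quotient.mk (cellSetoid H m) j = c := by
        have hrel : cellSetoid H m (Quotient.out (s := cellSetoid H m) c) j := ⟨_, hj⟩
        exact (Quotient.sound hrel).symm.trans (Quotient.out_eq (s := cellSetoid H m) c)
      simp [this]
    have := hT.to_subtype
    refine Finite.of_injective (β := T)
      (fun x : (Σ m, ((hD n).quotient (hinv n)).I m) => ⟨⟨x.1, x.2.1⟩, x.2.2⟩) ?_
    rintro ⟨m, c, hc⟩ ⟨m', c', hc'⟩ h
    cases congrArg Subtype.val h
    rfl

end Action

/-! ### Ends as sequences of vertices -/

section Ends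

theorem pi0_mk_eq_iff {X : Type*} [TopologicalSpace X] {S : Set X} {x y : X} (hx : x ∈ S)
    (hy : y ∈ S) :
    ZerothHomotopy.mk (⟨x, hx⟩ : S) = ZerothHomotopy.mk ⟨y, hy⟩ ↔ JoinedIn S x y := by
  rw [joinedIn_iff_joined hx hy]
  exact Quotient.eq (r := pathSetoid S)

variable {Y : Type*} [TopologicalSpace Y] [T2Space Y] [CWComplex (Set.univ : Set Y)]
  {L : Filtration Y}

/-- The end determined by a sequence of vertices. -/
def endOfVertices (r : ℕ → vertexSet Y)
    (hr : ∀ n, JoinedIn (cwCompl (L.sub n) : Set Y) (r n : Y) (r (n + 1))) : EndSpace L :=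
  ⟨fun n => ZerothHomotopy.mk ⟨r n, (hr n).source_mem⟩, fun n =>
    (pi0_mk_eq_iff (cwCompl_anti (L.mono n) (hr (n + 1)).source_mem) (hr n).source_mem).2
      (hr n).symm⟩

theorem endOfVertices_eq_iff {r s : ℕ → vertexSet Y}
    (hr : ∀ n, JoinedIn (cwCompl (L.sub n) : Set Y) (r n : Y) (r (n + 1)))
    (hs : ∀ n, JoinedIn (cwCompl (L.sub n) : Set Y) (s n : Y) (s (n + 1))) :
    endOfVertices r hr = endOfVertices s hs ↔
      ∀ n, JoinedIn (cwCompl (L.sub n) : Set Y) (r n : Y) (s n) := by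
  refine Subtype.ext_iff.trans (funext_iff.trans ?_)
  exact forall_congr' fun n => pi0_mk_eq_iff _ _

theorem exists_endOfVertices_eq (c : EndSpace L) : ∃ r hr, endOfVertices (L := L) r hr = c := by
  have h : ∀ n, ∃ v : vertexSet Y, ∃ hv : (v : Y) ∈ (cwCompl (L.sub n) : Set Y),
      ZerothHomotopy.mk ⟨v, hv⟩ = c.1 n := by
    intro n
    obtain ⟨⟨x, hx⟩, hxc⟩ := ZerothHomotopy.mk_surjective (c.1 n)
    obtain ⟨v, hv⟩ := (isSub_coe (cwCompl (L.sub n))).exists_joinedIn_vertex hx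
    exact ⟨v, hv.target_mem, ((pi0_mk_eq_iff hv.target_mem hx).2 hv.symm).trans hxc⟩
  choose r hr hrc using h
  refine ⟨r, fun n => ?_, Subtype.ext (funext hrc)⟩
  have h1 := c.2 n
  rw [← hrc n, ← hrc (n + 1)] at h1
  exact ((pi0_mk_eq_iff (cwCompl_anti (L.mono n) (hr (n + 1))) (hr n)).1 h1).symm

end Ends

/-! ### Comparison of rays with filtered ends -/

section RayEnds

variable {H Y : Type*} [Group H] [TopologicalSpace Y] [T2Space Y] [CWComplex (Set.univ : Set Y)]
  [MulAction H Y] [FreeGCW H Y] [ConnectedSpace Y] (hY : IsLocallyFiniteType (Set.univ : Set Y))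
  (L : Filtration Y)

/-- The vertices of the members of a filtration. -/
def vertexFiltration (n : ℕ) : Set (vertexSet Y) := {v | (v : Y) ∈ (L.sub n : Set Y)}

theorem joined_vertexFiltration_iff {n : ℕ} {v w : vertexSet Y} :
    (vertexConnectivity H hY).joined (vertexFiltration L n)ᶜ v w ↔
      JoinedIn (cwCompl (L.sub n) : Set Y) (v : Y) w := by
  rw [cwCompl_eq_fullSet]
  rfl

/-- Injectivity suffices to carry finiteness of the filtered ends over to the ray classes. -/
theorem exists_injective_ends :
    ∃ f : (vertexConnectivity H hY).Ends (vertexFiltration L) → EndSpace L,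
      Function.Injective f := by
  refine ⟨fun ε => endOfVertices ε.out.1
    fun n => (joined_vertexFiltration_iff hY L).1 (ε.out.2 n), fun ε ε' h => ?_⟩
  have h1 := (endOfVertices_eq_iff _ _).1 h
  rw [← Quotient.out_eq ε, ← Quotient.out_eq ε']
  exact Quotient.sound fun n => (joined_vertexFiltration_iff hY L).2 (h1 n)

variable {L}

theorem exists_ray_of_end (c : EndSpace L) :
    ∃ r hr, (vertexConnectivity H hY).IsRay (vertexFiltration L) r ∧
      endOfVertices (L := L) r hr = c := by
  obtain ⟨r, hr, hrc⟩ := exists_endOfVertices_eq c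
  exact ⟨r, hr, fun n => (joined_vertexFiltration_iff hY L).2 (hr n), hrc⟩

end RayEnds

end FilteredEnds

/-! ### The main theorem -/

theorem theorem1 {H : Type*} [Group H] {Y : Type*} [TopologicalSpace Y] [T2Space Y]
    [Topology.CWComplex (Set.univ : Set Y)] [MulAction H Y] [FilteredEnds.FreeGCW H Y]
    [PathConnectedSpace Y]
    (hY : FilteredEnds.IsLocallyFiniteType (Set.univ : Set Y))
    (K : Subgroup H) (hK : Infinite (H ⧸ K))
    (e : ℕ∞) (he : FilteredEnds.HasFilteredEnds (FilteredEnds.orbitMap H : Y → _) e)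
    (he_pos : 0 < e) (he_fin : e < ⊤) :
    FilteredEnds.HasFilteredEnds (FilteredEnds.orbitMap K : Y → _) 1 := by
  open FilteredEnds in
  obtain ⟨C, hC, L, hL, rfl⟩ := he
  have hfin : Finite (EndSpace L) := ENat.card_lt_top.1 he_fin
  obtain ⟨c⟩ : Nonempty (EndSpace L) := (ENat.card_ne_zero_iff_nonempty _).1 he_pos.ne'
  let J := vertexConnectivity H hY
  have hEnds : Finite (J.Ends (vertexFiltration L)) := by
    obtain ⟨f, hf⟩ := exists_injective_ends (H := H) hY L
    exact Finite.of_injective f hf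
  have hne : Nonempty (J.Ends (vertexFiltration L)) := by
    obtain ⟨r, -, hr, -⟩ := exists_ray_of_end (H := H) hY c
    exact ⟨Quotient.mk _ ⟨r, hr⟩⟩
  have : ∀ n, Countable (Topology.RelCWComplex.cell (Set.univ : Set Y) n) := countable_cell hY
  -- Any finite filtration of the orbit space of `K` would serve; countability of the cells provides
  -- one.
  obtain ⟨C', hC', L', hL'⟩ := exists_finite_filtration (H := K) (Y := Y)
  have hA : CofiniteExhaustion H (vertexFiltration L) := cofiniteExhaustion_of_filtration hC hL
  have hD := cofiniteExhaustion_of_filtration hC' hL'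
  have hD' : CofiniteExhaustion K (vertexFiltration L') :=
    ⟨hD.mono, hD.exhaust, hD.smul_mem, hD.finite⟩
  obtain ⟨r, hr, hru⟩ := exists_unique_ray J (fun _ _ h => eq_one_of_smul_vertex h) hA K hD'
  refine ⟨C', hC', L', hL', ?_⟩
  have hr' := fun n => (joined_vertexFiltration_iff hY L').1 (hr n)
  have huniq : ∀ c, c = endOfVertices (L := L') r hr' := by
    intro c
    obtain ⟨s, hs, hsr, rfl⟩ := exists_ray_of_end (H := H) hY c
    exact (endOfVertices_eq_iff hs hr').2
      fun n => (joined_vertexFiltration_iff hY L').1 (hru s hsr n)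
  have : Unique (EndSpace L') := ⟨⟨endOfVertices r hr'⟩, huniq⟩
  rw [Filtration.numEnds, ENat.card_eq_coe_natCard, Nat.card_unique]
  rfl
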